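/- Let $X$ be a connected Alexandroff space (a topological space in which arbitrary intersections of open sets are open), let $x_0\in X$, and let $H$ be a normal subgroup of $\pi_1(X,x_0)$. For $x\in X$ let $U_x$ be the intersection of all open sets containing $x$, and regard $X$ as a category with objects the points of $X$ and with a unique arrow $x\to y$ if $U_x\subseteq U_y$ (written $x\le y$) and no arrow $x\to y$ otherwise. Regard a group $G$ as a category with a single object $*$, with composition $g\circ h=gh$. Then there exist a group $G$ and a functor $\mathcal F\colon X\to G$ such that the canonical projection $p\colon \mathcal F\downarrow *\to X$ is the connected regular covering of $X$ that corresponds to $H$. Here $\mathcal F\downarrow *$ is the comma category: its objects are the pairs $(x,g)\in X\times G$, and there is a unique arrow $(x,g)\to(x',g')$ if $x\le x'$ and $g=g'\,\mathcal F(x\le x')$, and none otherwise. It is a preordered set, considered as an Alexandroff space whose open sets are the lower sets, and $p(x,g)=x$. Explicitly: $\mathcal F\downarrow *$ is connected; $p$ is a surjective covering map whose group of deck transformations acts transitively on each fibre; and $p_*\big(\pi_1(\mathcal F\downarrow *,\tilde x_0)\big)=H$ for every $\tilde x_0\in p^{-1}(x_0)$. -/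

import Mathlib

open CategoryTheory

universe u

/-- The minimal open set `U_x` of a point `x`: the intersection of all open sets containing `x`. -/
def minimalOpen {X : Type*} [TopologicalSpace X] (x : X) : Set X :=
  ⋂₀ {U : Set X | IsOpen U ∧ x ∈ U}

/-- The points of `X`, carrying the specialization preorder `x ≤ y ↔ U_x ⊆ U_y`, for which open
sets are lower sets. (Mathlib's `Specialization X` carries the opposite preorder.) Through
`Preorder.smallCategory` it is also the thin category with a unique arrow `x ⟶ y` iff `x ≤ y`. -/
def SpecOrder (X : Type*) : Type _ := X

namespace SpecOrder

variable {X : Type*}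

/-- The point of the space underlying an object of the category. -/
def toPoint (x : SpecOrder X) : X := x

/-- A point of the space as an object of the category. -/
def ofPoint (x : X) : SpecOrder X := x

variable [TopologicalSpace X]

instance : Preorder (SpecOrder X) where
  le x y := minimalOpen x.toPoint ⊆ minimalOpen y.toPoint
  le_refl _ := Set.Subset.refl _
  le_trans _ _ _ := Set.Subset.trans

theorem mem_minimalOpen (x : X) : x ∈ minimalOpen x := fun _ hU => hU.2

/-- `x ≤ y` iff `x ∈ U_y`. -/
theorem le_iff_mem {x y : SpecOrder X} : x ≤ y ↔ x.toPoint ∈ minimalOpen y.toPoint :=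
  ⟨fun h => h (mem_minimalOpen _), fun h _ hz U hU => hz U ⟨hU.1, h U hU⟩⟩

theorem mem_of_le {x y : SpecOrder X} (h : x ≤ y) {U : Set X} (hU : IsOpen U)
    (hy : y.toPoint ∈ U) : x.toPoint ∈ U :=
  le_iff_mem.1 h U ⟨hU, hy⟩

end SpecOrder

/-- The comma category `F ↓ *` of a functor `F : X ⥤ G`, where the group `G` is regarded as a
category with unique object `*`, and `*` also denotes the functor from the terminal category to `G`.
Composition in `SingleObj G` is `g ∘ f = g * f`. -/
def CommaSpace {X : Type*} [TopologicalSpace X] {G : Type*} [Group G]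
    (F : SpecOrder X ⥤ SingleObj G) : Type _ :=
  Comma F (Functor.fromPUnit.{0} (SingleObj.star G))

namespace CommaSpace

variable {X : Type*} [TopologicalSpace X] {G : Type*} [Group G] (F : SpecOrder X ⥤ SingleObj G)

instance : Category (CommaSpace F) :=
  inferInstanceAs (Category (Comma F (Functor.fromPUnit.{0} (SingleObj.star G))))

/-- `F ↓ *` is a thin category, that is, a preordered set. -/
instance : Quiver.IsThin (CommaSpace F) := fun _ _ =>
  ⟨fun _ _ => CommaMorphism.ext (Subsingleton.elim _ _) (Subsingleton.elim _ _)⟩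

/-- The preorder corresponding to the thin category `F ↓ *`. -/
instance : Preorder (CommaSpace F) where
  le a b := Nonempty (a ⟶ b)
  le_refl a := ⟨𝟙 a⟩
  le_trans _ _ _ := fun ⟨f⟩ ⟨g⟩ => ⟨f ≫ g⟩

/-- The preordered set `F ↓ *` as a topological space: the open sets are the lower sets. -/
instance : TopologicalSpace (CommaSpace F) := Topology.lowerSet (CommaSpace F)

/-- The canonical projection `F ↓ * → X`, as a continuous map. -/
def proj : C(CommaSpace F, X) where
  toFun a := (Comma.fst F (Functor.fromPUnit.{0} (SingleObj.star G)) |>.obj a).toPoint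
  continuous_toFun := ⟨fun _ hU _ _ h ha =>
    h.elim fun f => SpecOrder.mem_of_le (leOfHom f.left) hU ha⟩

end CommaSpace

/-- A regular (normal, Galois) covering: a surjective covering map whose group of deck
transformations acts transitively on every fibre. -/
structure IsRegularCovering {E X : Type*} [TopologicalSpace E] [TopologicalSpace X]
    (p : E → X) : Prop where
  isCoveringMap : IsCoveringMap p
  surjective : Function.Surjective p
  exists_deck : ∀ a b : E, p a = p b → ∃ φ : E ≃ₜ E, p ∘ φ = p ∧ φ a = b

/-!
Each minimal open set `U_y` of a space is contractible, because it can be contracted by jumping to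
`y` at the last instant (`SpecOrder.contractibleSpace_minimalOpen`). Hence for `x ≤ y` there is
exactly one homotopy class of paths from `x` to `y` inside `U_y`, and these classes assemble to a
functor `σ` from the specialization order to the fundamental groupoid
(`SpecOrder.toFundamentalGroupoid`).

Let `G = π₁(X, x₀) / H`. Since `X` is path connected, conjugation by chosen arrows out of `x₀`
extends the quotient map `π₁(X, x₀) → G` to a functor `Φ` from the fundamental groupoid to `G`
(`exists_functor_extending_quotient`). The functor of the theorem is `F = Φ ∘ σ`.

For every functor `F`, the group `G` acts on `F ↓ *` by left multiplication on the second
coordinate, the orbits are the fibres of the projection, and the translates of a principal lower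
set are disjoint. So the projection is a covering on which `G` acts by deck transformations,
transitively on fibres (`CommaSpace.isQuotientCoveringMap_proj`).

For `F = Φ ∘ σ`, a path in `F ↓ *` from `(x, g)` to `(y, h)` over `γ` satisfies `g = h * Φ γ`
(`CommaSpace.label_eq_mul_holonomy`). This holds by definition of the order for short paths, and
in general by subdivision. Consequently a loop `γ` at `x₀` lifts to a loop iff `Φ γ = 1`, that is,
iff `γ ∈ H`. As `Φ` is surjective on loops at `x₀`, every point can be joined to `(x₀, 1)`, so
`F ↓ *` is path connected.
-/

open Set unitInterval

/-! ### Minimal open sets and the fundamental groupoid -/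

namespace SpecOrder

variable {X : Type*} [TopologicalSpace X]

theorem isOpen_minimalOpen [AlexandrovDiscrete X] (x : X) : IsOpen (minimalOpen x) :=
  isOpen_sInter fun _ h => h.1

theorem isOpen_of_forall_minimalOpen_subset [AlexandrovDiscrete X] {V : Set X}
    (h : ∀ x ∈ V, minimalOpen x ⊆ V) : IsOpen V :=
  isOpen_iff_mem_nhds.2 fun x hx =>
    Filter.mem_of_superset ((isOpen_minimalOpen x).mem_nhds (mem_minimalOpen x)) (h x hx)

theorem minimalOpen_subset {x : X} {V : Set X} (hV : IsOpen V) (hx : x ∈ V) :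
    minimalOpen x ⊆ V :=
  fun _ hz => hz V ⟨hV, hx⟩

/-- The minimal open set of `y` contracts onto `y`: rest until the last instant, then jump to `y`.
This is continuous because the only open subset of `minimalOpen y` containing `y` is the whole. -/
instance contractibleSpace_minimalOpen (y : X) : ContractibleSpace (minimalOpen y) := by
  classical
  rw [contractible_iff_id_nullhomotopic]
  refine ⟨⟨y, mem_minimalOpen y⟩, ⟨⟨⟨fun p => if p.1 = 1 then ⟨y, mem_minimalOpen y⟩ else p.2,
    ⟨?_⟩⟩, fun z => by simp, fun z => by simp⟩⟩⟩
  rintro _ ⟨V, hV, rfl⟩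
  by_cases hy : y ∈ V
  · convert isOpen_univ
    ext p
    simp only [mem_preimage, mem_univ, iff_true]
    exact minimalOpen_subset hV hy (Subtype.coe_prop _)
  · have : IsOpen {p : I × minimalOpen y | p.1 ≠ 1 ∧ (p.2 : X) ∈ V} :=
      (isOpen_ne.preimage continuous_fst).inter
        (hV.preimage (continuous_subtype_val.comp continuous_snd))
    convert this using 1
    ext p
    by_cases hp : p.1 = 1 <;> simp [hp, hy]

/-- Paths inside a common minimal open set with the same endpoints are homotopic. -/
theorem homotopic_of_range_subset {y a b : X} (p q : Path a b)
    (hp : range p ⊆ minimalOpen y) (hq : range q ⊆ minimalOpen y) : p.Homotopic q := by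
  have hp' : ∀ t, p t ∈ minimalOpen y := fun t => hp ⟨t, rfl⟩
  have hq' : ∀ t, q t ∈ minimalOpen y := fun t => hq ⟨t, rfl⟩
  have ha : a ∈ minimalOpen y := by simpa using hp' 0
  have hb : b ∈ minimalOpen y := by simpa using hp' 1
  let p' : Path (⟨a, ha⟩ : minimalOpen y) ⟨b, hb⟩ :=
    ⟨⟨fun t => ⟨p t, hp' t⟩, by fun_prop⟩, by simp, by simp⟩
  let q' : Path (⟨a, ha⟩ : minimalOpen y) ⟨b, hb⟩ :=
    ⟨⟨fun t => ⟨q t, hq' t⟩, by fun_prop⟩, by simp, by simp⟩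
  exact (SimplyConnectedSpace.paths_homotopic p' q').map ⟨Subtype.val, continuous_subtype_val⟩

theorem exists_path_range_subset {x y : SpecOrder X} (h : x ≤ y) :
    ∃ p : Path x.toPoint y.toPoint, range p ⊆ minimalOpen y.toPoint := by
  let p := PathConnectedSpace.somePath
    (⟨x.toPoint, le_iff_mem.1 h⟩ : minimalOpen y.toPoint) ⟨y.toPoint, mem_minimalOpen _⟩
  refine ⟨p.map continuous_subtype_val, ?_⟩
  rintro _ ⟨t, rfl⟩
  exact Subtype.coe_prop _

/-- A path from `x` to `y` inside the minimal open set of `y`, for `x ≤ y`. -/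
noncomputable def lowerPath {x y : SpecOrder X} (h : x ≤ y) : Path x.toPoint y.toPoint :=
  (exists_path_range_subset h).choose

theorem range_lowerPath {x y : SpecOrder X} (h : x ≤ y) :
    range (lowerPath h) ⊆ minimalOpen y.toPoint :=
  (exists_path_range_subset h).choose_spec

variable (X) in
/-- The functor from the specialization order to the fundamental groupoid sending `x ≤ y` to the
unique homotopy class of paths from `x` to `y` inside the minimal open set of `y`. -/
noncomputable def toFundamentalGroupoid :
    SpecOrder X ⥤ FundamentalGroupoid X where
  obj x := .mk x.toPoint
  map f := Path.Homotopic.Quotient.mk (lowerPath (leOfHom f))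
  map_id x := Path.Homotopic.Quotient.eq.2 <|
    homotopic_of_range_subset _ _ (range_lowerPath _) (by
      change range (Path.refl x.toPoint) ⊆ _
      rw [Path.refl_range, singleton_subset_iff]
      exact mem_minimalOpen _)
  map_comp {x y z} f g := by
    refine Path.Homotopic.Quotient.eq.2 (homotopic_of_range_subset (y := z.toPoint) _
      ((lowerPath (leOfHom f)).trans (lowerPath (leOfHom g))) (range_lowerPath _) ?_)
    rw [Path.trans_range]
    exact union_subset ((range_lowerPath _).trans (leOfHom g)) (range_lowerPath _)

/-- A path that stays below `z` is homotopic to the canonical path up to `z` followed by the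
canonical path back down. -/
theorem mk_path_comp_toFundamentalGroupoid_map {x y z : SpecOrder X}
    (p : Path x.toPoint y.toPoint) (hp : range p ⊆ minimalOpen z.toPoint) (hx : x ≤ z)
    (hy : y ≤ z) :
    FundamentalGroupoid.fromPath (Path.Homotopic.Quotient.mk p) ≫
      (toFundamentalGroupoid X).map (homOfLE hy) = (toFundamentalGroupoid X).map (homOfLE hx) := by
  refine Path.Homotopic.Quotient.eq.2 (homotopic_of_range_subset (y := z.toPoint)
    (p.trans (lowerPath hy)) (lowerPath hx) ?_ (range_lowerPath _))
  rw [Path.trans_range]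
  exact union_subset hp (range_lowerPath _)

end SpecOrder

namespace CommaSpace

/-! ### The comma category in coordinates -/

section Order

variable {X : Type*} [TopologicalSpace X] {G : Type*} [Group G] {F : SpecOrder X ⥤ SingleObj G}

/-- The first coordinate `x` of the object `(x, g)` of `F ↓ *`. -/
def base (a : CommaSpace F) : SpecOrder X := Comma.left a

/-- The second coordinate `g` of the object `(x, g)` of `F ↓ *`. -/
def label (a : CommaSpace F) : G := Comma.hom a

/-- The value of `F` on the arrow `x ≤ y`, as an element of the group. -/
def weight (F : SpecOrder X ⥤ SingleObj G) {x y : SpecOrder X} (h : x ≤ y) : G :=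
  F.map (homOfLE h)

variable (F) in
/-- The object `(x, g)` of `F ↓ *`. -/
def mk (x : SpecOrder X) (g : G) : CommaSpace F :=
  { left := x, right := ⟨⟨⟩⟩, hom := g }

@[simp] theorem mk_base_label (a : CommaSpace F) : mk F a.base a.label = a := rfl

theorem ext_of_base_of_label {a b : CommaSpace F} (h : a.base = b.base) (h' : a.label = b.label) :
    a = b := by
  rw [← mk_base_label a, ← mk_base_label b, h, h']

theorem le_iff {a b : CommaSpace F} :
    a ≤ b ↔ ∃ h : a.base ≤ b.base, a.label = b.label * weight F h := by
  constructor
  · rintro ⟨f⟩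
    exact ⟨leOfHom f.left, ((Category.comp_id _).symm.trans f.w.symm)⟩
  · rintro ⟨h, h'⟩
    exact ⟨⟨homOfLE h, 𝟙 (⟨⟨⟩⟩ : Discrete PUnit),
      h'.symm.trans (Category.comp_id (Comma.hom a)).symm⟩⟩

theorem mk_mul_weight_le {x y : SpecOrder X} (h : x ≤ y) (g : G) :
    mk F x (g * weight F h) ≤ mk F y g :=
  le_iff.2 ⟨h, rfl⟩

theorem isOpen_iff_isLowerSet {V : Set (CommaSpace F)} : IsOpen V ↔ IsLowerSet V := Iff.rfl

theorem continuous_of_monotone {f : CommaSpace F → CommaSpace F} (hf : Monotone f) :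
    Continuous f :=
  ⟨fun _ hV => IsLowerSet.preimage hV hf⟩

/-- The structure group acts on `F ↓ *` by left multiplication of labels. -/
instance : MulAction G (CommaSpace F) where
  smul g a := mk F a.base (g * a.label)
  one_smul a := by
    change mk F a.base (1 * a.label) = a
    rw [one_mul, mk_base_label]
  mul_smul g h a := congrArg (mk F a.base) (mul_assoc g h a.label)

@[simp] theorem label_smul (g : G) (a : CommaSpace F) : (g • a).label = g * a.label := rfl

instance : ContinuousConstSMul G (CommaSpace F) where
  continuous_const_smul g := continuous_of_monotone fun a b h => by
    obtain ⟨h, h'⟩ := le_iff.1 h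
    exact le_iff.2 ⟨h, by rw [label_smul, label_smul, h', mul_assoc]; rfl⟩

theorem proj_eq_iff_mem_orbit {a b : CommaSpace F} :
    proj F a = proj F b ↔ a ∈ MulAction.orbit G b := by
  constructor
  · intro h
    exact ⟨a.label * b.label⁻¹, ext_of_base_of_label h.symm (by simp)⟩
  · rintro ⟨g, rfl⟩
    rfl

/-- The translates of a principal lower set are pairwise disjoint. -/
theorem eq_one_of_smul_Iic_inter_Iic {e : CommaSpace F} {g : G}
    (h : ((g • ·) '' Iic e ∩ Iic e).Nonempty) : g = 1 := by
  obtain ⟨_, ⟨a, ha, rfl⟩, hga⟩ := h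
  obtain ⟨h₁, h₁'⟩ := le_iff.1 ha
  obtain ⟨h₂, h₂'⟩ := le_iff.1 hga
  rw [label_smul, h₁'] at h₂'
  exact mul_eq_right.1 h₂'

end Order

/-! ### The projection is a regular covering -/

section Covering

variable {X : Type*} [TopologicalSpace X] {G : Type*} [Group G] (F : SpecOrder X ⥤ SingleObj G)

theorem proj_surjective : Function.Surjective (proj F) :=
  fun x => ⟨mk F (SpecOrder.ofPoint x) 1, rfl⟩

variable [AlexandrovDiscrete X]

theorem isOpenMap_proj : IsOpenMap (proj F) := by
  intro V hV
  refine SpecOrder.isOpen_of_forall_minimalOpen_subset ?_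
  rintro _ ⟨a, ha, rfl⟩ z hz
  have h : SpecOrder.ofPoint z ≤ a.base := SpecOrder.le_iff_mem.2 hz
  exact ⟨_, isOpen_iff_isLowerSet.1 hV (mk_mul_weight_le h a.label) ha, rfl⟩

/-- The projection is the quotient map of a free action with disjoint translates. -/
theorem isQuotientCoveringMap_proj : IsQuotientCoveringMap (proj F) G where
  toIsQuotientMap :=
    (isOpenMap_proj F).isQuotientMap (proj F).continuous (proj_surjective F)
  continuous_const_smul := continuous_const_smul
  apply_eq_iff_mem_orbit := proj_eq_iff_mem_orbit
  disjoint e := ⟨Iic e, IsOpen.mem_nhds (isOpen_iff_isLowerSet.2 (isLowerSet_Iic e)) self_mem_Iic,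
    fun _ => eq_one_of_smul_Iic_inter_Iic⟩

theorem isRegularCovering_proj : IsRegularCovering (proj F) where
  isCoveringMap := (isQuotientCoveringMap_proj F).isCoveringMap
  surjective := proj_surjective F
  exists_deck a b h := by
    obtain ⟨g, hg⟩ := proj_eq_iff_mem_orbit.1 h.symm
    exact ⟨Homeomorph.smul g, rfl, hg⟩

end Covering

/-! ### Holonomy of paths and monodromy of the covering -/

section Holonomy

variable {X : Type*} [TopologicalSpace X] {G : Type*} [Group G]
  (Φ : FundamentalGroupoid X ⥤ SingleObj G)

/-- The group element that `Φ` assigns to a homotopy class of paths. -/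
def holonomy {x y : X} (γ : Path.Homotopic.Quotient x y) : G :=
  Φ.map (FundamentalGroupoid.fromPath γ)

theorem holonomy_trans {x y z : X} (γ : Path.Homotopic.Quotient x y)
    (δ : Path.Homotopic.Quotient y z) :
    holonomy Φ (γ.trans δ) = holonomy Φ δ * holonomy Φ γ :=
  Φ.map_comp (FundamentalGroupoid.fromPath γ) (FundamentalGroupoid.fromPath δ)

@[simp] theorem holonomy_refl (x : X) : holonomy Φ (.refl x) = 1 :=
  Φ.map_id (FundamentalGroupoid.mk x)

@[simp] theorem holonomy_cast {x y x' y' : X} (γ : Path.Homotopic.Quotient x y) (hx : x' = x)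
    (hy : y' = y) : holonomy Φ (γ.cast hx hy) = holonomy Φ γ := by
  subst hx hy
  simp

variable {Φ}

/-- `label_eq_mul_holonomy` for a short path, one whose projection stays in a single minimal open
set over which both endpoints lie in the same sheet. -/
theorem label_eq_mul_holonomy_of_range_subset
    {a b e : CommaSpace (SpecOrder.toFundamentalGroupoid X ⋙ Φ)}
    (ha : a ≤ e) (hb : b ≤ e) (p : Path (proj _ a) (proj _ b))
    (hp : range p ⊆ minimalOpen (proj _ e)) :
    a.label = b.label * holonomy Φ (.mk p) := by
  obtain ⟨ha, ha'⟩ := le_iff.1 ha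
  obtain ⟨hb, hb'⟩ := le_iff.1 hb
  have h := congrArg Φ.map (SpecOrder.mk_path_comp_toFundamentalGroupoid_map
    (x := a.base) (y := b.base) (z := e.base) p hp ha hb)
  replace h := (Φ.map_comp _ _).symm.trans h
  rw [ha', hb', mul_assoc]
  exact congrArg (e.label * ·) h.symm

/-- Along a path in `F ↓ *`, the label changes by the holonomy of the projected path. -/
theorem label_eq_mul_holonomy {a b : CommaSpace (SpecOrder.toFundamentalGroupoid X ⋙ Φ)}
    (γ : Path.Homotopic.Quotient a b) :
    a.label = b.label * holonomy Φ (γ.map (proj _)) := by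
  induction γ using Path.Homotopic.Quotient.ind with | mk γ => ?_
  -- Subdivide so that each piece stays in a principal lower set.
  obtain ⟨t, ht₀, htm, ⟨n, hn⟩, ht⟩ := exists_monotone_Icc_subset_open_cover_unitInterval
    (c := fun e => γ ⁻¹' Iic e)
    (fun e => IsOpen.preimage γ.continuous (isOpen_iff_isLowerSet.2 (isLowerSet_Iic e)))
    (fun s _ => mem_iUnion.2 ⟨γ s, le_refl (γ s)⟩)
  let δ := γ.map (proj (SpecOrder.toFundamentalGroupoid X ⋙ Φ)).continuous
  have key : ∀ k, (γ (t 0)).label =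
      (γ (t k)).label * holonomy Φ (.mk (δ.subpath (t 0) (t k))) := by
    intro k
    induction k with
    | zero => simp
    | succ k ih =>
      obtain ⟨e, he⟩ := ht k
      have hk : t k ≤ t (k + 1) := htm k.le_succ
      have hδ : range (δ.subpath (t k) (t (k + 1))) ⊆ minimalOpen (proj _ e) := by
        rw [Path.range_subpath_of_le _ _ _ hk]
        rintro _ ⟨s, hs, rfl⟩
        exact SpecOrder.le_iff_mem.1 (le_iff.1 (he hs)).1
      have step : (γ (t k)).label =
          (γ (t (k + 1))).label * holonomy Φ (.mk (δ.subpath (t k) (t (k + 1)))) :=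
        label_eq_mul_holonomy_of_range_subset (he ⟨le_rfl, hk⟩) (he ⟨hk, le_rfl⟩) _ hδ
      have hom : Path.Homotopic.Quotient.mk (δ.subpath (t 0) (t (k + 1))) =
          (Path.Homotopic.Quotient.mk (δ.subpath (t 0) (t k))).trans
            (.mk (δ.subpath (t k) (t (k + 1)))) :=
        (Path.Homotopic.Quotient.eq.2 ⟨Path.Homotopy.subpathTransSubpath δ _ _ _⟩).symm
      rw [ih, step, hom, holonomy_trans, mul_assoc]
  have := key n
  rw [ht₀, hn n le_rfl, Path.subpath_zero_one, Path.Homotopic.Quotient.mk_cast,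
    holonomy_cast, γ.source, γ.target] at this
  exact this

variable [AlexandrovDiscrete X]

/-- Monodromy multiplies the label on the right by the inverse of the holonomy. -/
theorem label_eq_label_monodromy_mul_holonomy {x y : X} (γ : Path.Homotopic.Quotient x y)
    (e : proj (SpecOrder.toFundamentalGroupoid X ⋙ Φ) ⁻¹' {x}) :
    label e.1 = label ((isQuotientCoveringMap_proj _).isCoveringMap.monodromy γ e).1 *
      holonomy Φ γ := by
  have h := label_eq_mul_holonomy
    ((isQuotientCoveringMap_proj _).isCoveringMap.liftPathQuotient γ e)
  have h' := (isQuotientCoveringMap_proj _).isCoveringMap.map_liftPathQuotient γ e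
  rw [h]
  congr 1
  exact (congrArg (holonomy Φ) h').trans (holonomy_cast _ _ _ _)

theorem monodromy_eq_self_iff {x : X} (γ : Path.Homotopic.Quotient x x)
    (e : proj (SpecOrder.toFundamentalGroupoid X ⋙ Φ) ⁻¹' {x}) :
    (isQuotientCoveringMap_proj _).isCoveringMap.monodromy γ e = e ↔ holonomy Φ γ = 1 := by
  have h := label_eq_label_monodromy_mul_holonomy γ e
  constructor
  · intro he
    rw [he] at h
    exact left_eq_mul.1 h
  · intro hγ
    rw [hγ, mul_one] at h
    refine Subtype.ext (ext_of_base_of_label ?_ h.symm)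
    exact ((isQuotientCoveringMap_proj _).isCoveringMap.monodromy γ e).2.trans e.2.symm

/-- The image of the fundamental group of the covering consists of the loops with trivial
holonomy. -/
theorem mem_range_mapOfEq_proj_iff {x : X}
    (y : CommaSpace (SpecOrder.toFundamentalGroupoid X ⋙ Φ)) (hy : proj _ y = x)
    (γ : FundamentalGroup X x) :
    γ ∈ (FundamentalGroup.mapOfEq (proj _) hy).range ↔ holonomy Φ γ = 1 := by
  rw [← monodromy_eq_self_iff γ ⟨y, hy⟩,
    ← (isQuotientCoveringMap_proj _).monodromy_eq_id_iff ⟨y, hy⟩]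
  have h := (isQuotientCoveringMap_proj
    (SpecOrder.toFundamentalGroupoid X ⋙ Φ)).ker_monodromyPerm ⟨y, hy⟩
  refine (Iff.of_eq (congrArg (γ ∈ ·) h)).symm.trans ?_
  rw [MonoidHom.mem_ker, DFunLike.ext'_iff]
  rfl

theorem joined_monodromy {x y : X} (γ : Path.Homotopic.Quotient x y)
    (e : proj (SpecOrder.toFundamentalGroupoid X ⋙ Φ) ⁻¹' {x}) :
    Joined e.1 ((isQuotientCoveringMap_proj _).isCoveringMap.monodromy γ e).1 :=
  ⟨((isQuotientCoveringMap_proj _).isCoveringMap.liftPathQuotient γ e).out⟩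

/-- If loops at one point realize every element of `G` as holonomy, then `F ↓ *` is path
connected. -/
theorem pathConnectedSpace_of_holonomy_surjective [PathConnectedSpace X] (x₀ : X)
    (hΦ : Function.Surjective fun γ : Path.Homotopic.Quotient x₀ x₀ => holonomy Φ γ) :
    PathConnectedSpace (CommaSpace (SpecOrder.toFundamentalGroupoid X ⋙ Φ)) := by
  have key : ∀ a : CommaSpace (SpecOrder.toFundamentalGroupoid X ⋙ Φ),
      Joined a (mk _ (SpecOrder.ofPoint x₀) 1) := by
    intro a
    -- Correct an arbitrary path down to `x₀` by a loop so that the lift ends at label `1`.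
    let γ : Path.Homotopic.Quotient (proj _ a) x₀ := .mk (PathConnectedSpace.somePath _ _)
    obtain ⟨δ, hδ⟩ := hΦ (a.label * (holonomy Φ γ)⁻¹)
    have h := label_eq_label_monodromy_mul_holonomy (γ.trans δ) ⟨a, rfl⟩
    have hγδ : holonomy Φ (γ.trans δ) = a.label := by
      rw [holonomy_trans]
      exact (congrArg (· * holonomy Φ γ) hδ).trans (inv_mul_cancel_right _ _)
    rw [hγδ, right_eq_mul] at h
    have hj := joined_monodromy (γ.trans δ) ⟨a, rfl⟩
    rwa [ext_of_base_of_label (b := mk _ (SpecOrder.ofPoint x₀) 1)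
      ((isQuotientCoveringMap_proj _).isCoveringMap.monodromy (γ.trans δ) ⟨a, rfl⟩).2 h] at hj
  exact ⟨⟨mk _ (SpecOrder.ofPoint x₀) 1⟩, fun a b => (key a).trans (key b).symm⟩

end Holonomy

end CommaSpace

/-! ### Extending the quotient of the vertex group to the fundamental groupoid -/

section VertexGroup

variable {X : Type*} [TopologicalSpace X] [PathConnectedSpace X] (x₀ : X)

/-- A choice of homotopy classes of paths from the base point to all points, constant at the
base point itself. -/
theorem exists_arrows_from_basepoint :
    ∃ c : ∀ x : FundamentalGroupoid X, FundamentalGroupoid.mk x₀ ⟶ x, c (.mk x₀) = 𝟙 _ := by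
  let c (x : FundamentalGroupoid X) : FundamentalGroupoid.mk x₀ ⟶ x :=
    Path.Homotopic.Quotient.mk (PathConnectedSpace.somePath x₀ x.as)
  exact ⟨fun x => inv (c (.mk x₀)) ≫ c x, IsIso.inv_hom_id _⟩

/-- A functor from a path connected fundamental groupoid to the quotient of the vertex group at
`x₀` by a normal subgroup, extending the quotient map: conjugate an arrow `x ⟶ y`
into the vertex group by chosen arrows `x₀ ⟶ x` and `x₀ ⟶ y`. -/
theorem exists_functor_extending_quotient (H : Subgroup (FundamentalGroup X x₀)) [H.Normal] :
    ∃ Φ : FundamentalGroupoid X ⥤ SingleObj (FundamentalGroup X x₀ ⧸ H),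
      ∀ γ : FundamentalGroup X x₀,
        CommaSpace.holonomy Φ γ = (QuotientGroup.mk γ : FundamentalGroup X x₀ ⧸ H) := by
  obtain ⟨c, hc⟩ := exists_arrows_from_basepoint x₀
  refine ⟨{
    obj := fun _ => SingleObj.star _
    map := fun {x y} f => (QuotientGroup.mk (End.of (c x ≫ f ≫ inv (c y))) :
      FundamentalGroup X x₀ ⧸ H)
    map_id := fun x => ?_
    map_comp := fun {x y z} f g => ?_ }, fun γ => ?_⟩
  · rw [Category.id_comp, IsIso.hom_inv_id]
    rfl
  · rw [SingleObj.comp_as_mul, ← QuotientGroup.mk_mul]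
    congr 1
    change _ = (c x ≫ f ≫ inv (c y)) ≫ c y ≫ g ≫ inv (c z)
    simp
  · change (QuotientGroup.mk (End.of (c (.mk x₀) ≫ γ ≫ inv (c (.mk x₀)))) :
      FundamentalGroup X x₀ ⧸ H) = _
    rw [hc]
    simp

end VertexGroup

theorem mainTheorem3 {X : Type u} [TopologicalSpace X] [AlexandrovDiscrete X] [ConnectedSpace X]
    (x₀ : X) (H : Subgroup (FundamentalGroup X x₀)) (hH : H.Normal) :
    ∃ (G : Type u) (_ : Group G) (F : SpecOrder X ⥤ SingleObj G),
      ConnectedSpace (CommaSpace F) ∧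
      IsRegularCovering (CommaSpace.proj F) ∧
      ∀ (y : CommaSpace F) (hy : CommaSpace.proj F y = x₀),
        (FundamentalGroup.mapOfEq (CommaSpace.proj F) hy).range = H := by
  have : PathConnectedSpace X := pathConnectedSpace_iff_connectedSpace.2 inferInstance
  obtain ⟨Φ, hΦ⟩ := exists_functor_extending_quotient x₀ H
  refine ⟨FundamentalGroup X x₀ ⧸ H, inferInstance, SpecOrder.toFundamentalGroupoid X ⋙ Φ,
    ?_, CommaSpace.isRegularCovering_proj _, fun y hy => ?_⟩
  · have := CommaSpace.pathConnectedSpace_of_holonomy_surjective (Φ := Φ) x₀ fun g => by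
      obtain ⟨γ, rfl⟩ := QuotientGroup.mk_surjective g
      exact ⟨γ, hΦ γ⟩
    infer_instance
  · ext γ
    rw [CommaSpace.mem_range_mapOfEq_proj_iff, hΦ, QuotientGroup.eq_one_iff]
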